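/- **Proposition 3.3.** Let $S^3\subset\mathbb{R}^4=\mathbb{H}$ be the unit sphere with its round metric, and let $M=S^3\times(0,\infty)$ with the product metric and coordinate $y\in(0,\infty)$. Let $\mathfrak{e}_1,\mathfrak{e}_2,\mathfrak{e}_3$ be the orthonormal coframe on $S^3$ dual to the left-invariant frame $X_1=xi,\ X_2=xj,\ X_3=xk$, with $S^3$ oriented so that this frame is positive, and let $*_3$ be the Hodge star of $S^3$. Let $\mathfrak{t}_1,\mathfrak{t}_2,\mathfrak{t}_3$ be the basis $\mathfrak{t}_j=-\tfrac{\sqrt{-1}}{2}\sigma_j$ of $\mathfrak{su}(2)$ ($\sigma_j$ the Pauli matrices), so that $[\mathfrak{t}_i,\mathfrak{t}_j]=\epsilon_{ijk}\mathfrak{t}_k$. Forms with values in $\mathfrak{su}(2)$ have the pointwise norm given by $|u|^2\,d\mathrm{vol}=-\mathrm{tr}(u\wedge *u)$, and $\phi^2=\phi\wedge\phi$. Put $\omega=\sum_{i=1}^3\mathfrak{t}_i\mathfrak{e}_i$ and let $$(A^H,\phi^H)=\left(\frac{6e^{2y}}{e^{4y}+4e^{2y}+1}\,\omega,\ \frac{6(e^{2y}+1)e^{2y}}{(e^{4y}+4e^{2y}+1)(e^{2y}-1)}\,\omega\right)$$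 be He's explicit solution of the Kapustin–Witten equations. There is a constant $C_1\ge 0$, depending only on $(A^H,\phi^H)$, with the following property. Let $A$ and $\phi$ be smooth $\mathfrak{su}(2)$-valued one-forms on $M$ without $dy$ part ($A$ a connection form in temporal gauge, $\phi$ with $\phi_y=0$), and write $(A,\phi)=(A^H,\phi^H)+(\alpha,\rho)$. Suppose that $\rho=O(y)$ as $y\to0$, uniformly on $S^3$. Then $$\int_M\left|2\,\mathrm{tr}(\phi^H\wedge *\rho)\right|\ \le\ C_1+\int_M|\rho|^2+\frac12\int_M\left|*_3\partial_y\phi+\phi^2\right|^2 ,$$ where the integrals are taken with respect to the Riemannian measure of $M$ and have values in $[0,\infty]$. In particular, this holds, with the same $C_1$, for every solution $(A,\phi)$ of the Kapustin–Witten equations with the Nahm pole boundary condition (without knot) that is written in such a gauge. -/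

import Mathlib

open scoped Manifold ContDiff NNReal ENNReal

/-- The ambient space `ℝ⁴` of the unit sphere; a point `(a, b, c, d)` is also read as the
quaternion `a + b i + c j + d k`. -/
abbrev E4 : Type := EuclideanSpace ℝ (Fin 4)

/-- The unit three-sphere with its standard (round) metric. -/
abbrev S3 : Type := Metric.sphere (0 : E4) 1

/-- The tangent space of `S³` at `x`, with the metric induced from `ℝ⁴`. -/
abbrev TS3 (x : S3) : Type := ↥((ℝ ∙ (x : E4))ᗮ)

/-- The tangent vectors `x i`, `x j`, `x k` (quaternion multiplication) at `x`, as vectors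
of `ℝ⁴`. -/
noncomputable def frameVec (x : E4) : Fin 3 → E4 :=
  ![!₂[-x 1, x 0, x 3, -x 2],
    !₂[-x 2, -x 3, x 0, x 1],
    !₂[-x 3, x 2, -x 1, x 0]]

theorem frameVec_mem (x : E4) (i : Fin 3) : frameVec x i ∈ (ℝ ∙ x)ᗮ := by
  rw [Submodule.mem_orthogonal_singleton_iff_inner_right]
  fin_cases i <;> simp [frameVec, PiLp.inner_apply, Fin.sum_univ_four] <;> ring

/-- The left-invariant orthonormal frame `X₁, X₂, X₃` of the tangent bundle of `S³`. -/
noncomputable def frame (x : S3) (i : Fin 3) : TS3 x :=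
  ⟨frameVec (x : E4) i, frameVec_mem (x : E4) i⟩

/-- The dual orthonormal coframe `𝔢₁, 𝔢₂, 𝔢₃`. -/
noncomputable def coframe (x : S3) (i : Fin 3) : TS3 x →ₗ[ℝ] ℝ :=
  (innerSL ℝ (frame x i)).toLinearMap

/-- The Lie algebra `𝔰𝔲(2)`: traceless skew-Hermitian complex `2 × 2` matrices. -/
def su2 : Submodule ℝ (Matrix (Fin 2) (Fin 2) ℂ) where
  carrier := {a | a.conjTranspose = -a ∧ a.trace = 0}
  zero_mem' := by simp
  add_mem' := by
    rintro a b ⟨ha, ha'⟩ ⟨hb, hb'⟩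
    refine ⟨?_, ?_⟩
    · rw [Matrix.conjTranspose_add, ha, hb, neg_add]
    · rw [Matrix.trace_add, ha', hb', add_zero]
  smul_mem' := by
    rintro c a ⟨ha, ha'⟩
    refine ⟨?_, ?_⟩
    · rw [Matrix.conjTranspose_smul, ha, star_trivial, smul_neg]
    · rw [Matrix.trace_smul, ha', smul_zero]

/-- The matrices `-(√-1 / 2) σᵢ`, with `σᵢ` the Pauli matrices. -/
noncomputable def tMat : Fin 3 → Matrix (Fin 2) (Fin 2) ℂ :=
  ![!![0, -Complex.I / 2; -Complex.I / 2, 0],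
    !![0, -1 / 2; 1 / 2, 0],
    !![-Complex.I / 2, 0; 0, Complex.I / 2]]

theorem tMat_mem (i : Fin 3) : tMat i ∈ su2 := by
  refine ⟨?_, ?_⟩
  · fin_cases i <;> ext a b <;> fin_cases a <;> fin_cases b <;>
      simp [tMat, Matrix.conjTranspose_apply] <;> ring
  · fin_cases i <;> simp [tMat, Matrix.trace_fin_two]
    ring

/-- The generators `𝔱₁, 𝔱₂, 𝔱₃` of `𝔰𝔲(2)`, with `[𝔱ᵢ, 𝔱ⱼ] = εᵢⱼₖ 𝔱ₖ`. -/
noncomputable def tGen (i : Fin 3) : su2 := ⟨tMat i, tMat_mem i⟩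

/-- An `𝔰𝔲(2)`-valued one-form on `M = S³ × (0, ∞)`. At the point `(x, y)` it is a linear map
on `T₍ₓ,ᵧ₎M = TₓS³ × ℝ`, where `(0, 1)` is the vector `∂_y`. Only the values at `y > 0` matter;
those at `y ≤ 0` are never used. -/
abbrev OneForm : Type := (x : S3) → ℝ → (TS3 x × ℝ) →ₗ[ℝ] su2

/-- The `𝔰𝔲(2)`-valued one-form `ω = 𝔱₁ 𝔢₁ + 𝔱₂ 𝔢₂ + 𝔱₃ 𝔢₃` on `S³`. -/
noncomputable def omega (x : S3) : TS3 x →ₗ[ℝ] su2 :=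
  ∑ i, (coframe x i).smulRight (tGen i)

/-- The coefficient of `ω` in He's connection form. -/
noncomputable def heACoeff (y : ℝ) : ℝ :=
  6 * Real.exp (2 * y) / (Real.exp (4 * y) + 4 * Real.exp (2 * y) + 1)

/-- The coefficient of `ω` in He's Higgs field. -/
noncomputable def hePhiCoeff (y : ℝ) : ℝ :=
  6 * (Real.exp (2 * y) + 1) * Real.exp (2 * y) /
    ((Real.exp (4 * y) + 4 * Real.exp (2 * y) + 1) * (Real.exp (2 * y) - 1))

/-- He's connection form `A^H`. -/
noncomputable def heA : OneForm := fun x y =>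
  heACoeff y • (omega x).comp (LinearMap.fst ℝ (TS3 x) ℝ)

/-- He's Higgs field `φ^H`. -/
noncomputable def hePhi : OneForm := fun x y =>
  hePhiCoeff y • (omega x).comp (LinearMap.fst ℝ (TS3 x) ℝ)

namespace OneForm

/-- Smoothness on `M`: the matrix entries of the components of `u` in the smooth global frame
`X₁, X₂, X₃, ∂_y` are smooth functions on `S³ × (0, ∞)`. -/
def Smooth (u : OneForm) : Prop :=
  (∀ (i : Fin 3) (a b : Fin 2),
    ContMDiffOn ((𝓡 3).prod 𝓘(ℝ, ℝ)) 𝓘(ℝ, ℂ) ∞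
      (fun p : S3 × ℝ => (u p.1 p.2 (frame p.1 i, 0) : Matrix (Fin 2) (Fin 2) ℂ) a b)
      (Set.univ ×ˢ Set.Ioi 0)) ∧
  (∀ a b : Fin 2,
    ContMDiffOn ((𝓡 3).prod 𝓘(ℝ, ℝ)) 𝓘(ℝ, ℂ) ∞
      (fun p : S3 × ℝ => (u p.1 p.2 (0, 1) : Matrix (Fin 2) (Fin 2) ℂ) a b)
      (Set.univ ×ˢ Set.Ioi 0))

/-- `u` has no `dy` part. For a connection form this is the temporal gauge, for a Higgs field
it says that `φ_y = 0`. -/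
def NoDy (u : OneForm) : Prop := ∀ (x : S3) (y : ℝ), 0 < y → u x y (0, 1) = 0

/-- The function `tr (u ∧ * v) / dvol` on `M`, computed in the orthonormal frame
`X₁, X₂, X₃, ∂_y` (the traces are real, as `u` and `v` have values in `𝔰𝔲(2)`). -/
noncomputable def trWedgeStar (u v : OneForm) (x : S3) (y : ℝ) : ℝ :=
  ∑ i : Fin 3, (Matrix.trace ((u x y (frame x i, 0) : Matrix (Fin 2) (Fin 2) ℂ) *
      (v x y (frame x i, 0) : Matrix (Fin 2) (Fin 2) ℂ))).re +
    (Matrix.trace ((u x y (0, 1) : Matrix (Fin 2) (Fin 2) ℂ) *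
      (v x y (0, 1) : Matrix (Fin 2) (Fin 2) ℂ))).re

/-- The pointwise norm squared, `|u|² = -tr (u ∧ * u)`. -/
noncomputable def normSq (u : OneForm) (x : S3) (y : ℝ) : ℝ := -trWedgeStar u u x y

/-- `u = O(y ^ n)` as `y → 0`, uniformly on `S³`. -/
def IsBigOPow (u : OneForm) (n : ℕ) : Prop :=
  ∃ K δ : ℝ, 0 < δ ∧ ∀ (x : S3) (y : ℝ), 0 < y → y < δ → √(normSq u x y) ≤ K * y ^ n

/-- The form `∂_y u` on `S³` at height `y`, for the part of `u` along `S³`: the entrywise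
`y`-derivative of the matrices `u (v)`, for `v` tangent to `S³`. -/
noncomputable def partialY (u : OneForm) (x : S3) (y : ℝ) (v : TS3 x) : Matrix (Fin 2) (Fin 2) ℂ :=
  Matrix.of fun a b => deriv (fun s => (u x s (v, 0) : Matrix (Fin 2) (Fin 2) ℂ) a b) y

/-- The two-form `u² = u ∧ u` along `S³`: `(u ∧ u)(v, w) = u(v) u(w) - u(w) u(v)`. -/
noncomputable def wedgeSelf (u : OneForm) (x : S3) (y : ℝ) (v w : TS3 x) :
    Matrix (Fin 2) (Fin 2) ℂ :=
  (u x y (v, 0) : Matrix (Fin 2) (Fin 2) ℂ) * (u x y (w, 0) : Matrix (Fin 2) (Fin 2) ℂ) -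
    (u x y (w, 0) : Matrix (Fin 2) (Fin 2) ℂ) * (u x y (v, 0) : Matrix (Fin 2) (Fin 2) ℂ)

end OneForm

/-- The cross product on `TₓS³` for the orientation in which `X₁, X₂, X₃` is positive.
Indices are added modulo three. -/
noncomputable def crossS3 (x : S3) (v w : TS3 x) : TS3 x :=
  ∑ i : Fin 3, (coframe x (i + 1) v * coframe x (i + 2) w -
    coframe x (i + 2) v * coframe x (i + 1) w) • frame x i

/-- The Hodge star `*₃` of `S³` from one-forms to two-forms: `(*₃ u)(v, w) = u (v × w)`,
so that `*₃ 𝔢₁ = 𝔢₂ ∧ 𝔢₃` and cyclically. -/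
noncomputable def star3 (x : S3) (u : TS3 x → Matrix (Fin 2) (Fin 2) ℂ) (v w : TS3 x) :
    Matrix (Fin 2) (Fin 2) ℂ :=
  u (crossS3 x v w)

/-- The norm squared `|F|² = -tr (F ∧ *₃ F) / dvol` of an `𝔰𝔲(2)`-valued two-form on `S³`: the
sum of `-tr (F(Xⱼ, Xₖ)²)` over the three pairs `j, k`. -/
noncomputable def normSqTwo (x : S3) (F : TS3 x → TS3 x → Matrix (Fin 2) (Fin 2) ℂ) : ℝ :=
  ∑ i : Fin 3, -(Matrix.trace (F (frame x (i + 1)) (frame x (i + 2)) *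
    F (frame x (i + 1)) (frame x (i + 2)))).re

/-- The pointwise norm squared `|*₃ ∂_y φ + φ²|²`. -/
noncomputable def nahmDefectSq (φ : OneForm) (x : S3) (y : ℝ) : ℝ :=
  normSqTwo x fun v w => star3 x (φ.partialY x y) v w + φ.wedgeSelf x y v w

/-- The Riemannian measure of `M = S³ × (0, ∞)`: the product of the surface measure of `S³`
(of total mass `2π²`) with Lebesgue measure on `(0, ∞)`. -/
noncomputable def volM : MeasureTheory.Measure (S3 × ℝ) :=
  ((MeasureTheory.volume : MeasureTheory.Measure E4).toSphere).prod
    ((MeasureTheory.volume : MeasureTheory.Measure ℝ).restrict (Set.Ioi 0))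

/-- The integral over `M`, with values in `[0, ∞]`, of a nonnegative function. -/
noncomputable def integralM (f : S3 → ℝ → ℝ) : ℝ≥0∞ :=
  ∫⁻ p, ENNReal.ofReal (f p.1 p.2) ∂volM

/-! In the frames `𝔢ᵢ`, `𝔱ⱼ` the field φ is a 3 × 3 matrix P, φ^H is h·I with h = `hePhiCoeff`, ρ is
R = P - h·I, and `*₃ ∂_y φ + φ²` is N = P' + cof P. With T = tr R the left integrand is h|T|, where
h ~ 1/y at y = 0, so Cauchy–Schwarz alone does not suffice there.

Taking the trace of N gives T' + 2hT = tr N - 3(h' + h²) - e(R), with e(R) the sum of the principal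
2 × 2 minors. The poles cancel in h' + h², which is bounded (`hePhiCoeff_riccati_bound`), |e(R)| ≤ ∑
Rᵢⱼ² (`abs_minors_le`), and tr N is absorbed by Young's inequality. Hence, up to a constant and the
energy, 2h|T| is at most -|T|'. Since |T| is not differentiable at its zeros, √(T² + y²) replaces it
(`smoothed_kato`, `deriv_sqrt_trace_le`).

Integrating over (δ, 1] leaves the boundary value at δ. It tends to 0 because ρ = O(y), and the
constant in O(y) affects only how small δ must be, so the bound does not depend on ρ. On (1, ∞), h
decays exponentially and Young's inequality is enough. Integrating the half-line estimate
`lintegral_hePhiCoeff_mul_trace_le` over the compact sphere finishes the proof. -/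

/-! ### Reduction of forms to 3 × 3 matrices of real functions. -/

/-- The element of `𝔰𝔲(2)` with coordinates `v` in the basis `𝔱₁, 𝔱₂, 𝔱₃`. -/
noncomputable def suMat (v : Fin 3 → ℝ) : Matrix (Fin 2) (Fin 2) ℂ :=
  ∑ j, (v j : ℂ) • tMat j

/-- The coordinates of an element of `𝔰𝔲(2)` in the basis `𝔱₁, 𝔱₂, 𝔱₃`. -/
def suCoord (m : Matrix (Fin 2) (Fin 2) ℂ) : Fin 3 → ℝ :=
  ![-2 * (m 0 1).im, -2 * (m 0 1).re, -2 * (m 0 0).im]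

theorem suMat_eq (v : Fin 3 → ℝ) :
    suMat v = !![⟨0, -v 2 / 2⟩, ⟨-v 1 / 2, -v 0 / 2⟩; ⟨v 1 / 2, -v 0 / 2⟩, ⟨0, v 2 / 2⟩] := by
  ext a b
  fin_cases a <;> fin_cases b <;> apply Complex.ext <;>
    simp [suMat, tMat, Fin.sum_univ_three] <;> ring

theorem suMat_suCoord {m : Matrix (Fin 2) (Fin 2) ℂ} (hm : m ∈ su2) : suMat (suCoord m) = m := by
  obtain ⟨h, ht⟩ := hm
  have h00 := congrFun (congrFun h 0) 0
  have h01 := congrFun (congrFun h 0) 1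
  rw [Matrix.trace_fin_two] at ht
  simp only [Matrix.conjTranspose_apply, Matrix.neg_apply, Complex.ext_iff, Complex.neg_re,
    Complex.neg_im, Complex.star_def, Complex.conj_re, Complex.conj_im, Complex.add_re,
    Complex.add_im, Complex.zero_re, Complex.zero_im] at h00 h01 ht
  rw [suMat_eq]
  ext a b
  fin_cases a <;> fin_cases b <;> apply Complex.ext <;> simp [suCoord] <;> linarith

theorem suCoord_add (m n : Matrix (Fin 2) (Fin 2) ℂ) (j : Fin 3) :
    suCoord (m + n) j = suCoord m j + suCoord n j := by
  fin_cases j <;> simp [suCoord] <;> ring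

theorem suCoord_smul_tMat (c : ℝ) (i j : Fin 3) :
    suCoord (c • tMat i) j = if i = j then c else 0 := by
  fin_cases i <;> fin_cases j <;> simp [suCoord, tMat] <;> ring

/-- The `𝔱ⱼ` are orthogonal with square norm 1/2 for -tr; every factor 1/2 in the norms below comes
from here. -/
theorem trace_suMat_mul (v w : Fin 3 → ℝ) :
    (Matrix.trace (suMat v * suMat w)).re = -(1 / 2) * ∑ j, v j * w j := by
  simp [suMat_eq, Matrix.trace_fin_two, Fin.sum_univ_three]
  ring

/-- The relations [𝔱ᵢ, 𝔱ⱼ] = εᵢⱼₖ 𝔱ₖ identify 𝔰𝔲(2) with (ℝ³, ×). This turns φ ∧ φ into the cofactor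
matrix, whose rows are cross products of rows. -/
theorem suMat_commutator (v w : Fin 3 → ℝ) :
    suMat v * suMat w - suMat w * suMat v = suMat (crossProduct v w) := by
  ext a b
  fin_cases a <;> fin_cases b <;> apply Complex.ext <;>
    simp [suMat_eq, cross_apply] <;> ring

theorem suMat_add (v w : Fin 3 → ℝ) : suMat v + suMat w = suMat (v + w) := by
  simp [suMat, add_smul, Finset.sum_add_distrib]

theorem coframe_frame (x : S3) (i j : Fin 3) :
    coframe x i (frame x j) = if i = j then 1 else 0 := by
  have hx : (x : E4) 0 ^ 2 + (x : E4) 1 ^ 2 + (x : E4) 2 ^ 2 + (x : E4) 3 ^ 2 = 1 := by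
    have h : ‖(x : E4)‖ = 1 := by simp
    have h2 := EuclideanSpace.norm_sq_eq (x : E4)
    rw [h] at h2
    simp [Fin.sum_univ_four] at h2
    linarith
  have h : coframe x i (frame x j) = ∑ k, frameVec x j k * frameVec x i k := by
    change inner ℝ (frameVec (x : E4) i) (frameVec x j) = _
    simp [PiLp.inner_apply]
  rw [h]
  fin_cases i <;> fin_cases j <;> simp [frameVec, Fin.sum_univ_four] <;> linarith

theorem crossS3_frame (x : S3) (i : Fin 3) :
    crossS3 x (frame x (i + 1)) (frame x (i + 2)) = frame x i := by
  simp only [crossS3, coframe_frame, Fin.sum_univ_three]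
  fin_cases i <;> simp

theorem omega_frame (x : S3) (i : Fin 3) : omega x (frame x i) = tGen i := by
  simp [omega, coframe_frame]

/-- The operator `P ↦ P' + cof P` in components. -/
noncomputable def nahmOperator (P : Fin 3 → Fin 3 → ℝ → ℝ) (i j : Fin 3) (y : ℝ) : ℝ :=
  deriv (P i j) y + crossProduct (fun k => P (i + 1) k y) (fun k => P (i + 2) k y) j

namespace OneForm

/-- The component of `u` along `𝔢ᵢ ⊗ 𝔱ⱼ`. -/
noncomputable def component (u : OneForm) (x : S3) (i j : Fin 3) (y : ℝ) : ℝ :=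
  suCoord (u x y (frame x i, 0)) j

theorem apply_frame (u : OneForm) (x : S3) (i : Fin 3) (y : ℝ) :
    (u x y (frame x i, 0) : Matrix (Fin 2) (Fin 2) ℂ) = suMat fun j => u.component x i j y :=
  (suMat_suCoord (u x y (frame x i, 0)).2).symm

theorem component_add (u v : OneForm) (x : S3) (i j : Fin 3) (y : ℝ) :
    (u + v).component x i j y = u.component x i j y + v.component x i j y := by
  simp only [component, ← suCoord_add]
  rfl

theorem component_hePhi (x : S3) (i j : Fin 3) (y : ℝ) :
    hePhi.component x i j y = if i = j then hePhiCoeff y else 0 := by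
  rw [← suCoord_smul_tMat]
  simp [component, hePhi, omega_frame, tGen]

theorem noDy_hePhi : hePhi.NoDy := fun x y _ => by simp [hePhi]

theorem trWedgeStar_eq {u v : OneForm} (hv : v.NoDy) (x : S3) {y : ℝ} (hy : 0 < y) :
    trWedgeStar u v x y =
      -(1 / 2) * ∑ i, ∑ j, u.component x i j y * v.component x i j y := by
  simp only [trWedgeStar, hv x y hy, apply_frame, trace_suMat_mul, ← Finset.mul_sum]
  simp

theorem normSq_eq {u : OneForm} (hu : u.NoDy) (x : S3) {y : ℝ} (hy : 0 < y) :
    normSq u x y = 1 / 2 * ∑ i, ∑ j, u.component x i j y ^ 2 := by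
  simp only [normSq, trWedgeStar_eq hu x hy, sq]
  ring

theorem partialY_frame {u : OneForm} {x : S3} {i : Fin 3} {y : ℝ}
    (hu : ∀ j, DifferentiableAt ℝ (u.component x i j) y) :
    u.partialY x y (frame x i) = suMat fun j => deriv (u.component x i j) y := by
  ext a b
  have h : ∀ j, HasDerivAt (fun s => ((u.component x i j s : ℝ) : ℂ) * tMat j a b)
      (((deriv (u.component x i j) y : ℝ) : ℂ) * tMat j a b) y := fun j =>
    (hu j).hasDerivAt.ofReal_comp.mul_const _
  have h2 := (HasDerivAt.fun_sum (u := Finset.univ) fun j _ => h j).deriv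
  simp only [partialY, apply_frame, suMat, Matrix.of_apply, Matrix.sum_apply, Matrix.smul_apply,
    smul_eq_mul, h2]

theorem nahmDefectSq_eq {u : OneForm} {x : S3} {y : ℝ}
    (hu : ∀ i j, DifferentiableAt ℝ (u.component x i j) y) :
    nahmDefectSq u x y = 1 / 2 * ∑ i, ∑ j, nahmOperator (u.component x) i j y ^ 2 := by
  simp only [nahmDefectSq, normSqTwo, star3, crossS3_frame, partialY_frame (hu _), wedgeSelf,
    apply_frame, suMat_commutator, suMat_add, trace_suMat_mul, Finset.mul_sum]
  refine Finset.sum_congr rfl fun i _ => ?_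
  rw [← Finset.sum_neg_distrib]
  refine Finset.sum_congr rfl fun j _ => ?_
  simp only [nahmOperator, Pi.add_apply]
  ring

theorem Smooth.contMDiffOn_component {u : OneForm} (hu : u.Smooth) (i j : Fin 3) :
    ContMDiffOn ((𝓡 3).prod 𝓘(ℝ, ℝ)) 𝓘(ℝ, ℝ) ∞
      (fun p : S3 × ℝ => u.component p.1 i j p.2) (Set.univ ×ˢ Set.Ioi 0) := by
  have him : ∀ a b, ContMDiffOn ((𝓡 3).prod 𝓘(ℝ, ℝ)) 𝓘(ℝ, ℝ) ∞
      (fun p : S3 × ℝ => -2 * ((u p.1 p.2 (frame p.1 i, 0) : Matrix (Fin 2) (Fin 2) ℂ) a b).im)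
      (Set.univ ×ˢ Set.Ioi 0) := fun a b =>
    ((-2 : ℝ) • Complex.imCLM).contMDiff.comp_contMDiffOn (hu.1 i a b)
  have hre : ∀ a b, ContMDiffOn ((𝓡 3).prod 𝓘(ℝ, ℝ)) 𝓘(ℝ, ℝ) ∞
      (fun p : S3 × ℝ => -2 * ((u p.1 p.2 (frame p.1 i, 0) : Matrix (Fin 2) (Fin 2) ℂ) a b).re)
      (Set.univ ×ˢ Set.Ioi 0) := fun a b =>
    ((-2 : ℝ) • Complex.reCLM).contMDiff.comp_contMDiffOn (hu.1 i a b)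
  fin_cases j
  · exact him 0 1
  · exact hre 0 1
  · exact him 0 0

theorem Smooth.contDiffOn_component {u : OneForm} (hu : u.Smooth) (x : S3) (i j : Fin 3) :
    ContDiffOn ℝ ∞ (u.component x i j) (Set.Ioi 0) := by
  rw [← contMDiffOn_iff_contDiffOn]
  have h : ContMDiff 𝓘(ℝ, ℝ) ((𝓡 3).prod 𝓘(ℝ, ℝ)) ∞ (fun s : ℝ => (x, s)) :=
    contMDiff_const.prodMk contMDiff_id
  exact (hu.contMDiffOn_component i j).comp h.contMDiffOn fun s hs => ⟨trivial, hs⟩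

end OneForm

/-! ### Estimates for He's coefficient h, as a rational function of E = exp(2y). -/

theorem hePhiCoeff_denom_pos {y : ℝ} (hy : 0 < y) : 0 < Real.exp (2 * y) - 1 := by
  have := Real.add_one_lt_exp (x := 2 * y) (by linarith)
  linarith

theorem exp_four_mul (y : ℝ) : Real.exp (4 * y) = Real.exp (2 * y) ^ 2 := by
  rw [sq, ← Real.exp_add]; ring_nf

theorem hePhiCoeff_nonneg {y : ℝ} (hy : 0 < y) : 0 ≤ hePhiCoeff y := by
  have := hePhiCoeff_denom_pos hy
  unfold hePhiCoeff
  positivity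

/-- The derivative is split so that the double pole at y = 0 sits entirely in -h²; the other term
has no pole. -/
theorem hasDerivAt_hePhiCoeff {y : ℝ} (hy : 0 < y) :
    HasDerivAt hePhiCoeff (-hePhiCoeff y ^ 2 -
      12 * Real.exp (2 * y) * (Real.exp (2 * y) ^ 2 + Real.exp (2 * y) + 1) /
        (Real.exp (2 * y) ^ 2 + 4 * Real.exp (2 * y) + 1) ^ 2) y := by
  have hE : HasDerivAt (fun y : ℝ => Real.exp (2 * y)) (2 * Real.exp (2 * y)) y := by
    have := ((hasDerivAt_id y).const_mul 2).exp
    simp only [id, mul_one] at this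
    rwa [mul_comm] at this
  have h1 := hePhiCoeff_denom_pos hy
  have hpos := Real.exp_pos (2 * y)
  have hf : hePhiCoeff = fun y => 6 * (Real.exp (2 * y) + 1) * Real.exp (2 * y) /
    ((Real.exp (2 * y) ^ 2 + 4 * Real.exp (2 * y) + 1) * (Real.exp (2 * y) - 1)) := by
    funext y; rw [hePhiCoeff, exp_four_mul]
  have hq : Real.exp (2 * y) ^ 2 + 4 * Real.exp (2 * y) + 1 ≠ 0 := by positivity
  rw [hf]
  have := (((hE.add_const 1).const_mul 6).fun_mul hE).fun_div
    ((((hE.fun_pow 2).fun_add (hE.const_mul 4)).add_const 1).fun_mul (hE.sub_const 1))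
    (mul_ne_zero hq h1.ne')
  refine this.congr_deriv ?_
  have h1' := h1.ne'
  beta_reduce
  generalize Real.exp (2 * y) = E at *
  field_simp
  ring

theorem hePhiCoeff_riccati_bound {y : ℝ} (hy : 0 < y) :
    |deriv hePhiCoeff y + hePhiCoeff y ^ 2| ≤ 12 := by
  rw [(hasDerivAt_hePhiCoeff hy).deriv]
  have hpos := Real.exp_pos (2 * y)
  generalize Real.exp (2 * y) = E at *
  rw [show ∀ a b : ℝ, -a - b + a = -b by intros; ring, abs_neg, abs_of_nonneg (by positivity),
    div_le_iff₀ (by positivity)]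
  have : 0 ≤ 12 * ((E ^ 2 + 4 * E + 1) ^ 2 - E * (E ^ 2 + E + 1)) := by
    ring_nf; positivity
  linarith

/-- From 2y ≤ E - 1, which cancels the simple pole. This controls the error made by smoothing |T|.
-/
theorem hePhiCoeff_mul_self_le {y : ℝ} (hy : 0 < y) : hePhiCoeff y * y ≤ 3 := by
  have h := Real.add_one_lt_exp (x := 2 * y) (by linarith)
  have h1 := hePhiCoeff_denom_pos hy
  have hpos := Real.exp_pos (2 * y)
  rw [hePhiCoeff, exp_four_mul, div_mul_eq_mul_div, div_le_iff₀ (by positivity)]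
  generalize Real.exp (2 * y) = E at *
  calc 6 * (E + 1) * E * y ≤ 6 * (E + 1) * E * ((E - 1) / 2) := by gcongr; linarith
    _ = 3 * ((E ^ 2 + E) * (E - 1)) := by ring
    _ ≤ 3 * ((E ^ 2 + 4 * E + 1) * (E - 1)) := by
      gcongr ?_ * (?_ * _)
      linarith

theorem hePhiCoeff_le_exp {y : ℝ} (hy : 1 ≤ y) : hePhiCoeff y ≤ 12 * Real.exp (-y) := by
  have h := Real.add_one_lt_exp (x := 2 * y) (by linarith)
  have h1 := hePhiCoeff_denom_pos (y := y) (by linarith)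
  have hpos := Real.exp_pos (2 * y)
  have h2 : 12 * (Real.exp (2 * y))⁻¹ ≤ 12 * Real.exp (-y) := by
    rw [← Real.exp_neg]
    gcongr
    linarith
  refine le_trans ?_ h2
  rw [hePhiCoeff, exp_four_mul, div_le_iff₀ (by positivity)]
  generalize Real.exp (2 * y) = E at *
  have : 12 * E⁻¹ * ((E ^ 2 + 4 * E + 1) * (E - 1)) = 12 * ((E ^ 2 + 4 * E + 1) * (E - 1)) / E := by
    field_simp
  rw [this, le_div_iff₀ hpos]
  have hE : 3 ≤ E := by linarith
  -- Here E ≥ 2y + 1 ≥ 3; in powers of E - 3 the difference of the two sides has only nonnegative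
  -- coefficients.
  obtain ⟨z, rfl⟩ : ∃ z, E = 3 + z := ⟨E - 3, by ring⟩
  have hz : 0 ≤ z := by linarith
  have : 0 ≤ 12 * (((3 + z) ^ 2 + 4 * (3 + z) + 1) * (3 + z - 1)) -
    6 * (3 + z + 1) * (3 + z) * (3 + z) := by ring_nf; positivity
  linarith

/-! ### Pointwise inequalities for the trace. -/

/-- The sum of the principal `2 × 2` minors is at most the sum of the squares of the entries. -/
theorem abs_minors_le (r : Fin 3 → Fin 3 → ℝ) :
    |(r 0 0 * r 1 1 - r 0 1 * r 1 0) + (r 1 1 * r 2 2 - r 1 2 * r 2 1) +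
      (r 2 2 * r 0 0 - r 2 0 * r 0 2)| ≤ ∑ i, ∑ j, r i j ^ 2 := by
  simp only [Fin.sum_univ_three]
  rw [abs_le]
  constructor
  · linarith [sq_nonneg (r 0 0 + r 1 1 + r 2 2), sq_nonneg (r 0 1 - r 1 0),
      sq_nonneg (r 1 2 - r 2 1), sq_nonneg (r 2 0 - r 0 2), sq_nonneg (r 0 0), sq_nonneg (r 1 1),
      sq_nonneg (r 2 2), sq_nonneg (r 0 1 ), sq_nonneg (r 1 0), sq_nonneg (r 0 2),
      sq_nonneg (r 2 0), sq_nonneg (r 1 2), sq_nonneg (r 2 1)]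
  · linarith [sq_nonneg (r 0 0 - r 1 1), sq_nonneg (r 1 1 - r 2 2), sq_nonneg (r 2 2 - r 0 0),
      sq_nonneg (r 0 1 + r 1 0), sq_nonneg (r 1 2 + r 2 1), sq_nonneg (r 2 0 + r 0 2),
      sq_nonneg (r 0 1 ), sq_nonneg (r 1 0), sq_nonneg (r 0 2),
      sq_nonneg (r 2 0), sq_nonneg (r 1 2), sq_nonneg (r 2 1)]

theorem sq_trace_le (r : Fin 3 → Fin 3 → ℝ) :
    (∑ i, r i i) ^ 2 ≤ 3 * ∑ i, ∑ j, r i j ^ 2 := by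
  simp only [Fin.sum_univ_three]
  linarith [sq_nonneg (r 0 0 - r 1 1), sq_nonneg (r 1 1 - r 2 2), sq_nonneg (r 2 2 - r 0 0),
    sq_nonneg (r 0 1 ), sq_nonneg (r 1 0), sq_nonneg (r 0 2),
    sq_nonneg (r 2 0), sq_nonneg (r 1 2), sq_nonneg (r 2 1)]

/-- A smoothed Kato inequality: if `T' + 2 h T = d - 3 k - e`, then `h |T|` is bounded in terms of
`|d|`, `|k|`, `|e|` and the derivative of `√(T² + y²)`. -/
theorem smoothed_kato {y T T' h d k e : ℝ} (hy : 0 < y) (hh : 0 ≤ h)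
    (hT : T' + 2 * h * T = d - 3 * k - e) :
    2 * (h * |T|) ≤ -((T * T' + y) / √(T ^ 2 + y ^ 2)) + 2 * (h * y) + 1 + |d| + 3 * |k| + |e| := by
  set s := √(T ^ 2 + y ^ 2) with hs
  have hs2 : s ^ 2 = T ^ 2 + y ^ 2 := Real.sq_sqrt (by positivity)
  have hspos : 0 < s := Real.sqrt_pos.2 (by positivity)
  have hys : y ≤ s := Real.le_sqrt_of_sq_le (by nlinarith)
  have hTs : |T| ≤ s := Real.abs_le_sqrt (by nlinarith)
  have hsT : s ≤ |T| + y := by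
    refine Real.sqrt_le_iff.2 ⟨by positivity, ?_⟩
    nlinarith [sq_abs T, abs_nonneg T]
  have hw : T * (d - 3 * k - e) ≤ s * (|d| + 3 * |k| + |e|) := by
    calc T * (d - 3 * k - e) ≤ |T * (d - 3 * k - e)| := le_abs_self _
      _ = |T| * |d - 3 * k - e| := abs_mul _ _
      _ ≤ s * (|d| + 3 * |k| + |e|) := by
        gcongr
        calc |d - 3 * k - e| ≤ |d - 3 * k| + |e| := abs_sub _ _
          _ ≤ |d| + |3 * k| + |e| := by gcongr; exact abs_sub _ _
          _ = _ := by rw [abs_mul]; norm_num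
  -- The damping term 2hT²/s thus keeps 2h|T| up to a loss 2hy, which stays bounded since h is of
  -- order 1/y. A constant ε in place of y would lose the non-integrable 2hε.
  have hTT : s * (|T| - y) ≤ T ^ 2 := by
    have h1 : (|T| - y) * s ≤ |T| ^ 2 := by
      rcases le_total |T| y with h2 | h2
      · nlinarith [sq_nonneg |T|]
      · nlinarith
    rw [sq_abs] at h1; linarith
  have hh2 := mul_le_mul_of_nonneg_left hTT hh
  have key : (T * T' + y) / s ≤ -(2 * h * (|T| - y)) + (|d| + 3 * |k| + |e|) + 1 := by
    rw [div_le_iff₀ hspos]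
    have : T' = (d - 3 * k - e) - 2 * h * T := by linarith
    rw [this]
    nlinarith
  linarith

/-! ### Integration of differential inequalities near y = 0. -/

open MeasureTheory in
/-- Integrated form of a differential inequality `ψ' ≤ 2 (c + g - f)` on `(0, 1]`. -/
theorem lintegral_Ioc_le_of_deriv_le {f g ψ ψ' : ℝ → ℝ} {c : ℝ} (hc : 0 ≤ c)
    (hf : ContinuousOn f (Set.Ioi 0)) (hg : ContinuousOn g (Set.Ioi 0))
    (hf0 : ∀ y, 0 < y → 0 ≤ f y) (hg0 : ∀ y, 0 < y → 0 ≤ g y)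
    (hψ : ∀ y, 0 < y → HasDerivAt ψ (ψ' y) y) (hψ0 : 0 ≤ ψ 1)
    (h : ∀ y, 0 < y → y ≤ 1 → ψ' y ≤ 2 * (c + g y - f y)) {δ : ℝ} (hδ : 0 < δ) (hδ1 : δ ≤ 1) :
    ∫⁻ y in Set.Ioc δ 1, ENNReal.ofReal (f y) ≤
      ENNReal.ofReal (ψ δ / 2 + c) + ∫⁻ y in Set.Ioc δ 1, ENNReal.ofReal (g y) := by
  have hsub : Set.Icc δ 1 ⊆ Set.Ioi 0 := fun y hy => lt_of_lt_of_le hδ hy.1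
  have hfi : IntegrableOn f (Set.Icc δ 1) := (hf.mono hsub).integrableOn_Icc
  have hgi : IntegrableOn g (Set.Icc δ 1) := (hg.mono hsub).integrableOn_Icc
  have hci : IntegrableOn (fun _ : ℝ => c) (Set.Icc δ 1) := continuousOn_const.integrableOn_Icc
  have hfi' : IntervalIntegrable f volume δ 1 :=
    (intervalIntegrable_iff_integrableOn_Icc_of_le hδ1).2 hfi
  have hgi' : IntervalIntegrable g volume δ 1 :=
    (intervalIntegrable_iff_integrableOn_Icc_of_le hδ1).2 hgi
  -- In this form of the fundamental theorem only the upper bound for ψ' has to be integrable, not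
  -- ψ' itself.
  have hftc := intervalIntegral.sub_le_integral_of_hasDeriv_right_of_le hδ1
    (fun y hy => (hψ y (hsub hy)).continuousAt.continuousWithinAt)
    (fun y hy => (hψ y (hδ.trans hy.1)).hasDerivWithinAt)
    (φ := fun y => 2 * (c + g y - f y)) (((hci.add hgi).sub hfi).const_mul 2)
    (fun y hy => h y (hδ.trans hy.1) hy.2.le)
  rw [intervalIntegral.integral_const_mul,
    intervalIntegral.integral_sub (intervalIntegrable_const.add hgi') hfi',
    intervalIntegral.integral_add intervalIntegrable_const hgi',
    intervalIntegral.integral_const, smul_eq_mul, intervalIntegral.integral_of_le hδ1,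
    intervalIntegral.integral_of_le hδ1] at hftc
  have hcδ : 0 ≤ c * δ := by positivity
  have hnn : ∀ u : ℝ → ℝ, (∀ y, 0 < y → 0 ≤ u y) → 0 ≤ᵐ[volume.restrict (Set.Ioc δ 1)] u :=
    fun u hu => (ae_restrict_iff' measurableSet_Ioc).2
      (Filter.Eventually.of_forall fun y hy => hu y (hδ.trans hy.1))
  rw [← ofReal_integral_eq_lintegral_ofReal (hfi.mono_set Set.Ioc_subset_Icc_self) (hnn f hf0),
    ← ofReal_integral_eq_lintegral_ofReal (hgi.mono_set Set.Ioc_subset_Icc_self) (hnn g hg0)]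
  refine (ENNReal.ofReal_le_ofReal ?_).trans ENNReal.ofReal_add_le
  linarith

open MeasureTheory in
/-- A bound for the integrals over `(δ, 1]`, for small `δ`, bounds the integral over `(0, 1]`. -/
theorem lintegral_Ioc_zero_le {f : ℝ → ℝ≥0∞} {b : ℝ≥0∞} {δ₀ : ℝ} (hδ₀ : 0 < δ₀)
    (h : ∀ δ, 0 < δ → δ ≤ 1 → δ < δ₀ → ∫⁻ y in Set.Ioc δ 1, f y ≤ b) :
    ∫⁻ y in Set.Ioc 0 1, f y ≤ b := by
  have hU : Set.Ioc (0 : ℝ) 1 = ⋃ n : ℕ, Set.Ioc (1 / ((n : ℝ) + 1)) 1 := by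
    ext y
    simp only [Set.mem_Ioc, Set.mem_iUnion]
    constructor
    · rintro ⟨h0, h1⟩
      obtain ⟨n, hn⟩ := exists_nat_one_div_lt h0
      exact ⟨n, hn, h1⟩
    · rintro ⟨n, hn, h1⟩
      exact ⟨lt_trans (by positivity) hn, h1⟩
  have hmono : Monotone fun n : ℕ => Set.Ioc (1 / ((n : ℝ) + 1)) (1 : ℝ) := fun m n hmn =>
    Set.Ioc_subset_Ioc_left (Nat.one_div_le_one_div hmn)
  rw [hU, setLIntegral_iUnion_of_directed _ hmono.directed_le]
  refine iSup_le fun n => ?_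
  have hpos : (0 : ℝ) < 1 / ((n : ℝ) + 1) := by positivity
  -- Half of δ₀ makes the inequality δ < δ₀ strict; shrinking δ only enlarges the interval.
  have hδ : 0 < min (1 / ((n : ℝ) + 1)) (min 1 (δ₀ / 2)) := by positivity
  refine (lintegral_mono_set ?_).trans (h _ hδ
    ((min_le_right _ _).trans (min_le_left _ _)) ?_)
  · exact Set.Ioc_subset_Ioc_left (min_le_left _ _)
  · exact ((min_le_right _ _).trans (min_le_right _ _)).trans_lt (by linarith)

/-! ### The estimate on a single half-line. -/

/-- The difference between the components of a Higgs field and those of He's solution. -/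
noncomputable def heRemainder (P : Fin 3 → Fin 3 → ℝ → ℝ) (i j : Fin 3) (y : ℝ) : ℝ :=
  P i j y - if i = j then hePhiCoeff y else 0

/-- The energy density `|ρ|² + |*₃ ∂_y φ + φ²|² / 2` in components. -/
noncomputable def energyDensity (P : Fin 3 → Fin 3 → ℝ → ℝ) (y : ℝ) : ℝ :=
  1 / 2 * (∑ i, ∑ j, heRemainder P i j y ^ 2) + 1 / 2 * (1 / 2 * ∑ i, ∑ j, nahmOperator P i j y ^ 2)

theorem energyDensity_nonneg (P : Fin 3 → Fin 3 → ℝ → ℝ) (y : ℝ) : 0 ≤ energyDensity P y := by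
  unfold energyDensity
  positivity

theorem continuousOn_hePhiCoeff : ContinuousOn hePhiCoeff (Set.Ioi 0) := fun _ hy =>
  (hasDerivAt_hePhiCoeff hy).continuousAt.continuousWithinAt

theorem continuousOn_heRemainder {P : Fin 3 → Fin 3 → ℝ → ℝ}
    (hP : ∀ i j, ContDiffOn ℝ ∞ (P i j) (Set.Ioi 0)) (i j : Fin 3) :
    ContinuousOn (heRemainder P i j) (Set.Ioi 0) := by
  unfold heRemainder
  refine (hP i j).continuousOn.sub ?_
  split_ifs
  exacts [continuousOn_hePhiCoeff, continuousOn_const]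

theorem continuousOn_nahmOperator {P : Fin 3 → Fin 3 → ℝ → ℝ}
    (hP : ∀ i j, ContDiffOn ℝ ∞ (P i j) (Set.Ioi 0)) (i j : Fin 3) :
    ContinuousOn (nahmOperator P i j) (Set.Ioi 0) := by
  have hd := (hP i j).continuousOn_deriv_of_isOpen isOpen_Ioi (by simp)
  have hc := fun i j => (hP i j).continuousOn
  unfold nahmOperator
  refine hd.add ?_
  fin_cases j <;> simp only [cross_apply] <;>
    exact ((hc _ _).mul (hc _ _)).sub ((hc _ _).mul (hc _ _))

theorem continuousOn_energyDensity {P : Fin 3 → Fin 3 → ℝ → ℝ}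
    (hP : ∀ i j, ContDiffOn ℝ ∞ (P i j) (Set.Ioi 0)) : ContinuousOn (energyDensity P) (Set.Ioi 0) := by
  unfold energyDensity
  refine (continuousOn_const.mul ?_).add (continuousOn_const.mul (continuousOn_const.mul ?_)) <;>
    refine continuousOn_finsetSum _ fun i _ => continuousOn_finsetSum _ fun j _ => ?_
  exacts [(continuousOn_heRemainder hP i j).pow 2, (continuousOn_nahmOperator hP i j).pow 2]

theorem hasDerivAt_trace_heRemainder {P : Fin 3 → Fin 3 → ℝ → ℝ}
    (hP : ∀ i j, ContDiffOn ℝ ∞ (P i j) (Set.Ioi 0)) {y : ℝ} (hy : 0 < y) :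
    HasDerivAt (fun y => ∑ i, heRemainder P i i y)
      (∑ i, deriv (P i i) y - 3 * deriv hePhiCoeff y) y := by
  have hd : ∀ i, HasDerivAt (heRemainder P i i) (deriv (P i i) y - deriv hePhiCoeff y) y := by
    intro i
    have h1 := ((hP i i).differentiableOn (by simp)).differentiableAt (Ioi_mem_nhds hy)
    have h2 := (hasDerivAt_hePhiCoeff hy).differentiableAt
    refine (h1.hasDerivAt.sub h2.hasDerivAt).congr_of_eventuallyEq ?_
    exact Filter.Eventually.of_forall fun s => by simp [heRemainder]
  refine (HasDerivAt.fun_sum (u := Finset.univ) fun i _ => hd i).congr_deriv ?_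
  simp [Finset.sum_sub_distrib]

/-- The constant collects 2hy ≤ 6, 3|h' + h²| ≤ 36, the 1 from smoothing and 3/2 from Young's
inequality: 44.5 ≤ 2 · 23. -/
theorem deriv_sqrt_trace_le (P : Fin 3 → Fin 3 → ℝ → ℝ) {y : ℝ} (hy : 0 < y) :
    ((∑ i, heRemainder P i i y) * (∑ i, deriv (P i i) y - 3 * deriv hePhiCoeff y) + y) /
      √((∑ i, heRemainder P i i y) ^ 2 + y ^ 2) ≤
    2 * (23 + energyDensity P y - hePhiCoeff y * |∑ i, heRemainder P i i y|) := by
  have hd2 := sq_trace_le fun i j => nahmOperator P i j y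
  have hminor := abs_minors_le fun i j => heRemainder P i j y
  have hk := hePhiCoeff_riccati_bound hy
  have hm := hePhiCoeff_mul_self_le hy
  have hh := hePhiCoeff_nonneg hy
  have key := smoothed_kato (T := ∑ i, heRemainder P i i y)
    (T' := ∑ i, deriv (P i i) y - 3 * deriv hePhiCoeff y)
    (d := ∑ i, nahmOperator P i i y) (k := deriv hePhiCoeff y + hePhiCoeff y ^ 2)
    (e := (heRemainder P 0 0 y * heRemainder P 1 1 y - heRemainder P 0 1 y * heRemainder P 1 0 y) +
      (heRemainder P 1 1 y * heRemainder P 2 2 y - heRemainder P 1 2 y * heRemainder P 2 1 y) +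
      (heRemainder P 2 2 y * heRemainder P 0 0 y - heRemainder P 2 0 y * heRemainder P 0 2 y)) hy hh
    (by
      -- The principal minors of h·I + R sum to 3h² + 2hT + e(R).
      simp only [nahmOperator, heRemainder, Fin.sum_univ_three, cross_apply]
      simp
      ring)
  -- The weight 1/6 is chosen so that (tr N)² ≤ 3 ∑ Nᵢⱼ² yields ∑ Nᵢⱼ² / 2, exactly the share of N
  -- in twice the energy density.
  have hd3 : |∑ i, nahmOperator P i i y| ≤ (∑ i, nahmOperator P i i y) ^ 2 / 6 + 3 / 2 := by
    rw [← sq_abs (∑ i, nahmOperator P i i y)]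
    nlinarith [sq_nonneg (|∑ i, nahmOperator P i i y| - 3)]
  unfold energyDensity
  linarith

open MeasureTheory

/-- A bound for the contribution of `φ^H` alone, on each half-line `{x} × (0, ∞)`. -/
noncomputable def heBound : ℝ≥0∞ :=
  ENNReal.ofReal 24 + ∫⁻ y in Set.Ioi (1 : ℝ), ENNReal.ofReal (216 * Real.exp (-y))

theorem heBound_ne_top : heBound ≠ ⊤ := by
  refine ENNReal.add_ne_top.2 ⟨ENNReal.ofReal_ne_top, ?_⟩
  exact (((integrableOn_exp_neg_Ioi 1).const_mul 216).lintegral_lt_top).ne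

/-- Young's inequality h|T| ≤ 3h²/2 + T²/6 with T² ≤ 3 ∑ Rᵢⱼ²; the constant is 216 = (3/2) · 12². -/
theorem hePhiCoeff_mul_trace_le (P : Fin 3 → Fin 3 → ℝ → ℝ) {y : ℝ} (hy : 1 ≤ y) :
    hePhiCoeff y * |∑ i, heRemainder P i i y| ≤ 216 * Real.exp (-y) + energyDensity P y := by
  have h0 := hePhiCoeff_nonneg (y := y) (by linarith)
  have h1 := hePhiCoeff_le_exp hy
  have hT := sq_trace_le fun i j => heRemainder P i j y
  have he : Real.exp (-y) ≤ 1 := Real.exp_le_one_iff.2 (by linarith)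
  have he0 := Real.exp_pos (-y)
  have hsq : hePhiCoeff y ^ 2 ≤ 144 * Real.exp (-y) := by
    calc hePhiCoeff y ^ 2 ≤ (12 * Real.exp (-y)) ^ 2 := by gcongr
      _ = 144 * (Real.exp (-y) * Real.exp (-y)) := by ring
      _ ≤ 144 * (Real.exp (-y) * 1) := by gcongr
      _ = _ := by ring
  have hN : 0 ≤ ∑ i, ∑ j, nahmOperator P i j y ^ 2 := by positivity
  rw [← sq_abs] at hT
  unfold energyDensity
  nlinarith [sq_nonneg (3 * hePhiCoeff y - |∑ i, heRemainder P i i y|)]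

/-- The asserted inequality on a half-line `{x} × (0, ∞)`. -/
theorem lintegral_hePhiCoeff_mul_trace_le {P : Fin 3 → Fin 3 → ℝ → ℝ}
    (hP : ∀ i j, ContDiffOn ℝ ∞ (P i j) (Set.Ioi 0)) {K δ₀ : ℝ} (hδ₀ : 0 < δ₀)
    (hK : ∀ y, 0 < y → y < δ₀ → (∑ i, heRemainder P i i y) ^ 2 ≤ K * y ^ 2) :
    ∫⁻ y in Set.Ioi 0, ENNReal.ofReal (hePhiCoeff y * |∑ i, heRemainder P i i y|) ≤
      heBound + ∫⁻ y in Set.Ioi 0, ENNReal.ofReal (energyDensity P y) := by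
  have hdisj : Disjoint (Set.Ioc (0 : ℝ) 1) (Set.Ioi 1) := Set.Ioc_disjoint_Ioi le_rfl
  have hfar : ∫⁻ y in Set.Ioi 1, ENNReal.ofReal (hePhiCoeff y * |∑ i, heRemainder P i i y|) ≤
      (∫⁻ y in Set.Ioi (1 : ℝ), ENNReal.ofReal (216 * Real.exp (-y))) +
        ∫⁻ y in Set.Ioi 1, ENNReal.ofReal (energyDensity P y) := by
    rw [← lintegral_add_left (by fun_prop)]
    refine setLIntegral_mono' measurableSet_Ioi fun y hy => ?_
    exact (ENNReal.ofReal_le_ofReal (hePhiCoeff_mul_trace_le P (le_of_lt hy))).trans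
      ENNReal.ofReal_add_le
  have hnear : ∫⁻ y in Set.Ioc 0 1, ENNReal.ofReal (hePhiCoeff y * |∑ i, heRemainder P i i y|) ≤
      ENNReal.ofReal 24 + ∫⁻ y in Set.Ioc 0 1, ENNReal.ofReal (energyDensity P y) := by
    have hK1 : 0 < |K| + 1 := by positivity
    -- Below 1/(|K| + 1) one has T² + δ² ≤ (|K| + 1)δ² < δ ≤ 1. The boundary term is then at most
    -- 1/2, so 24 suffices for 23 + 1/2, whatever K is.
    refine lintegral_Ioc_zero_le (δ₀ := min δ₀ (1 / (|K| + 1))) (by positivity)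
      fun δ hδ hδ1 hlt => ?_
    have hT := fun y hy => hasDerivAt_trace_heRemainder hP (y := y) hy
    have hψ : ∀ y, 0 < y → HasDerivAt (fun y => √((∑ i, heRemainder P i i y) ^ 2 + y ^ 2))
        (((∑ i, heRemainder P i i y) * (∑ i, deriv (P i i) y - 3 * deriv hePhiCoeff y) + y) /
          √((∑ i, heRemainder P i i y) ^ 2 + y ^ 2)) y := by
      intro y hy
      have hne : (∑ i, heRemainder P i i y) ^ 2 + y ^ 2 ≠ 0 := by positivity
      refine ((((hT y hy).fun_pow 2).fun_add ((hasDerivAt_id y).fun_pow 2)).sqrt hne).congr_deriv ?_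
      simp only [id]
      push_cast
      ring
    have hfc : ContinuousOn (fun y => hePhiCoeff y * |∑ i, heRemainder P i i y|) (Set.Ioi 0) :=
      continuousOn_hePhiCoeff.mul
        (continuousOn_finsetSum _ fun i _ => continuousOn_heRemainder hP i i).abs
    refine (lintegral_Ioc_le_of_deriv_le (by norm_num : (0 : ℝ) ≤ 23) hfc
      (continuousOn_energyDensity hP)
      (fun y hy => mul_nonneg (hePhiCoeff_nonneg hy) (abs_nonneg _))
      (fun y _ => energyDensity_nonneg P y) hψ (Real.sqrt_nonneg _)
      (fun y hy _ => deriv_sqrt_trace_le P hy) hδ hδ1).trans ?_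
    gcongr
    have hψδ : √((∑ i, heRemainder P i i δ) ^ 2 + δ ^ 2) ≤ 1 := by
      refine Real.sqrt_le_one.2 ?_
      have h1 := hK δ hδ (hlt.trans_le (min_le_left _ _))
      have h2 : δ * (|K| + 1) < 1 := (lt_div_iff₀ hK1).1 (hlt.trans_le (min_le_right _ _))
      nlinarith [le_abs_self K, sq_nonneg δ]
    linarith
  rw [← Set.Ioc_union_Ioi_eq_Ioi (zero_le_one (α := ℝ)), lintegral_union measurableSet_Ioi hdisj,
    lintegral_union measurableSet_Ioi hdisj]
  refine (add_le_add hnear hfar).trans (le_of_eq ?_)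
  rw [heBound]
  ring

/-! ### Measurability on M. -/

theorem volM_eq : volM = (((volume : Measure E4).toSphere).prod (volume : Measure ℝ)).restrict
    (Set.univ ×ˢ Set.Ioi 0) := by
  rw [← Measure.prod_restrict, Measure.restrict_univ, volM]

theorem measurableSet_univ_prod_Ioi : MeasurableSet ((Set.univ : Set S3) ×ˢ Set.Ioi (0 : ℝ)) :=
  MeasurableSet.univ.prod measurableSet_Ioi

theorem ae_volM_pos : ∀ᵐ p ∂volM, 0 < p.2 := by
  rw [volM_eq]
  exact (ae_restrict_mem measurableSet_univ_prod_Ioi).mono fun p hp => hp.2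

theorem aemeasurable_volM {f : S3 × ℝ → ℝ} (hf : ContinuousOn f (Set.univ ×ˢ Set.Ioi 0)) :
    AEMeasurable f volM := by
  rw [volM_eq]
  exact hf.aemeasurable measurableSet_univ_prod_Ioi

open Filter Topology in
/-- The `y`-derivative of a continuous function is measurable, as a limit of difference
quotients. -/
theorem aemeasurable_volM_deriv {f : S3 → ℝ → ℝ}
    (hf : ContinuousOn (fun p : S3 × ℝ => f p.1 p.2) (Set.univ ×ˢ Set.Ioi 0))
    (hd : ∀ x y, 0 < y → DifferentiableAt ℝ (f x) y) :
    AEMeasurable (fun p => deriv (f p.1) p.2) volM := by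
  refine aemeasurable_of_tendsto_metrizable_ae (ι := ℕ) atTop
    (f := fun n p => (1 / ((n : ℝ) + 1))⁻¹ • (f p.1 (p.2 + 1 / ((n : ℝ) + 1)) - f p.1 p.2))
    (fun n => ?_) ?_
  · refine aemeasurable_volM (ContinuousOn.fun_smul continuousOn_const (ContinuousOn.fun_sub ?_ hf))
    refine hf.comp (f := fun p : S3 × ℝ => (p.1, p.2 + 1 / ((n : ℝ) + 1))) (by fun_prop)
      fun p hp => ⟨trivial, ?_⟩
    have hp2 : 0 < p.2 := hp.2
    change 0 < p.2 + 1 / ((n : ℝ) + 1)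
    positivity
  · refine ae_volM_pos.mono fun p hp => ?_
    have h := (hd p.1 p.2 hp).hasDerivAt.tendsto_slope_zero
    refine h.comp (tendsto_nhdsWithin_iff.2 ⟨tendsto_one_div_add_atTop_nhds_zero_nat, ?_⟩)
    exact Eventually.of_forall fun n => by
      simp only [Set.mem_compl_iff, Set.mem_singleton_iff]
      positivity

namespace OneForm

theorem Smooth.differentiableAt_component {u : OneForm} (hu : u.Smooth) (x : S3) (i j : Fin 3)
    {y : ℝ} (hy : 0 < y) : DifferentiableAt ℝ (u.component x i j) y :=
  ((hu.contDiffOn_component x i j).differentiableOn (by simp)).differentiableAt (Ioi_mem_nhds hy)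

theorem Smooth.aemeasurable_component {u : OneForm} (hu : u.Smooth) (i j : Fin 3) :
    AEMeasurable (fun p : S3 × ℝ => u.component p.1 i j p.2) volM :=
  aemeasurable_volM (hu.contMDiffOn_component i j).continuousOn

theorem Smooth.aemeasurable_heRemainder {u : OneForm} (hu : u.Smooth) (i j : Fin 3) :
    AEMeasurable (fun p : S3 × ℝ => heRemainder (u.component p.1) i j p.2) volM := by
  unfold heRemainder
  refine (hu.aemeasurable_component i j).sub ?_
  split_ifs
  · refine aemeasurable_volM ?_
    exact continuousOn_hePhiCoeff.comp continuousOn_snd fun p hp => hp.2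
  · exact aemeasurable_const

theorem Smooth.aemeasurable_nahmOperator {u : OneForm} (hu : u.Smooth) (i j : Fin 3) :
    AEMeasurable (fun p : S3 × ℝ => nahmOperator (u.component p.1) i j p.2) volM := by
  unfold nahmOperator
  refine (aemeasurable_volM_deriv (hu.contMDiffOn_component i j).continuousOn
    fun x y hy => hu.differentiableAt_component x i j hy).add ?_
  have hc := hu.aemeasurable_component
  fin_cases j <;> simp only [cross_apply] <;>
    exact ((hc _ _).mul (hc _ _)).sub ((hc _ _).mul (hc _ _))

theorem Smooth.aemeasurable_sum_heRemainder {u : OneForm} (hu : u.Smooth) :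
    AEMeasurable (fun p : S3 × ℝ => 1 / 2 * ∑ i, ∑ j, heRemainder (u.component p.1) i j p.2 ^ 2)
      volM := by
  have := hu.aemeasurable_heRemainder
  fun_prop

theorem Smooth.aemeasurable_energyDensity {u : OneForm} (hu : u.Smooth) :
    AEMeasurable (fun p : S3 × ℝ => energyDensity (u.component p.1) p.2) volM := by
  have := hu.aemeasurable_nahmOperator
  unfold energyDensity
  exact hu.aemeasurable_sum_heRemainder.add (by fun_prop)

/-! ### Return to forms, and integration over the sphere. -/

theorem component_of_eq_hePhi_add {φ ρ : OneForm} (h : φ = hePhi + ρ) (x : S3) (i j : Fin 3)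
    (y : ℝ) : ρ.component x i j y = heRemainder (φ.component x) i j y := by
  rw [heRemainder, h, component_add, component_hePhi]
  ring

theorem noDy_of_eq_hePhi_add {φ ρ : OneForm} (h : φ = hePhi + ρ) (hφ : φ.NoDy) : ρ.NoDy := by
  intro x y hy
  have h1 := hφ x y hy
  have h2 : φ x y (0, 1) = hePhi x y (0, 1) + ρ x y (0, 1) := by rw [h]; rfl
  rwa [h2, noDy_hePhi x y hy, zero_add] at h1

theorem abs_trWedgeStar_hePhi {φ ρ : OneForm} (h : φ = hePhi + ρ) (hφ : φ.NoDy) (x : S3) {y : ℝ}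
    (hy : 0 < y) : |2 * trWedgeStar hePhi ρ x y| =
      hePhiCoeff y * |∑ i, heRemainder (φ.component x) i i y| := by
  rw [trWedgeStar_eq (noDy_of_eq_hePhi_add h hφ) x hy]
  simp only [component_hePhi, component_of_eq_hePhi_add h, ite_mul, zero_mul, Finset.sum_ite_eq,
    Finset.mem_univ, if_true, ← Finset.mul_sum]
  rw [← abs_of_nonneg (hePhiCoeff_nonneg hy), ← abs_mul, ← abs_neg,
    abs_of_nonneg (hePhiCoeff_nonneg hy)]
  congr 1
  ring

theorem IsBigOPow.sq_trace_le {φ ρ : OneForm} (h : φ = hePhi + ρ) (hφ : φ.NoDy)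
    (hρ : ρ.IsBigOPow 1) : ∃ K δ : ℝ, 0 < δ ∧ ∀ x y, 0 < y → y < δ →
      (∑ i, heRemainder (φ.component x) i i y) ^ 2 ≤ K * y ^ 2 := by
  obtain ⟨K, δ, hδ, hK⟩ := hρ
  refine ⟨6 * K ^ 2, δ, hδ, fun x y hy hyδ => ?_⟩
  have h1 := hK x y hy hyδ
  have h2 := _root_.sq_trace_le fun i j => heRemainder (φ.component x) i j y
  rw [normSq_eq (noDy_of_eq_hePhi_add h hφ) x hy] at h1
  simp only [component_of_eq_hePhi_add h, pow_one] at h1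
  have h3 := (Real.sqrt_le_iff.1 h1).2
  linarith

end OneForm

theorem proposition3p3 :
    ∃ C₁ : ℝ≥0, ∀ A φ α ρ : OneForm,
      A.Smooth → φ.Smooth → A.NoDy → φ.NoDy →
      A = heA + α → φ = hePhi + ρ → ρ.IsBigOPow 1 →
      integralM (fun x y => |2 * OneForm.trWedgeStar hePhi ρ x y|) ≤
        (C₁ : ℝ≥0∞) + integralM (fun x y => ρ.normSq x y) +
          (1 / 2 : ℝ≥0∞) * integralM (fun x y => nahmDefectSq φ x y) := by
  have hC : heBound * (volume : Measure E4).toSphere Set.univ ≠ ⊤ :=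
    ENNReal.mul_ne_top heBound_ne_top (measure_ne_top _ _)
  -- The half-line bound times the area of the sphere: it involves only h.
  refine ⟨(heBound * (volume : Measure E4).toSphere Set.univ).toNNReal, ?_⟩
  intro A φ α ρ _ hφ _ hφy _ h hρ
  rw [ENNReal.coe_toNNReal hC, add_assoc]
  obtain ⟨K, δ₀, hδ₀, hK⟩ := OneForm.IsBigOPow.sq_trace_le h hφy hρ
  have hrhs : integralM (fun x y => ρ.normSq x y) +
      (1 / 2 : ℝ≥0∞) * integralM (fun x y => nahmDefectSq φ x y) =
      ∫⁻ p, ENNReal.ofReal (energyDensity (φ.component p.1) p.2) ∂volM := by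
    rw [integralM, integralM, ← lintegral_const_mul' _ _ (by simp)]
    have h1 : ∫⁻ p, ENNReal.ofReal (ρ.normSq p.1 p.2) ∂volM = ∫⁻ p, ENNReal.ofReal
        (1 / 2 * ∑ i, ∑ j, heRemainder (φ.component p.1) i j p.2 ^ 2) ∂volM := by
      refine lintegral_congr_ae (ae_volM_pos.mono fun p hp => ?_)
      simp only [OneForm.normSq_eq (OneForm.noDy_of_eq_hePhi_add h hφy) p.1 hp,
        OneForm.component_of_eq_hePhi_add h]
    rw [h1, ← lintegral_add_left' hφ.aemeasurable_sum_heRemainder.ennreal_ofReal]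
    refine lintegral_congr_ae (ae_volM_pos.mono fun p hp => ?_)
    have h2 : (1 / 2 : ℝ≥0∞) = ENNReal.ofReal (1 / 2) := by
      rw [ENNReal.ofReal_div_of_pos (by norm_num)]; simp
    simp only [OneForm.nahmDefectSq_eq fun i j => hφ.differentiableAt_component p.1 i j hp]
    rw [h2, ← ENNReal.ofReal_mul (by norm_num), energyDensity,
      ENNReal.ofReal_add (by positivity) (by positivity)]
  rw [hrhs]
  -- On the left only the inequality half of Tonelli's theorem is needed, which requires no
  -- measurability; the energy needs the equality. Infinite energy is no separate case, as all
  -- integrals lie in [0, ∞].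
  calc integralM (fun x y => |2 * OneForm.trWedgeStar hePhi ρ x y|)
      ≤ ∫⁻ x, (∫⁻ y in Set.Ioi 0, ENNReal.ofReal |2 * OneForm.trWedgeStar hePhi ρ x y|)
          ∂(volume : Measure E4).toSphere := lintegral_prod_le _
    _ ≤ ∫⁻ x, (heBound + ∫⁻ y in Set.Ioi 0, ENNReal.ofReal (energyDensity (φ.component x) y))
          ∂(volume : Measure E4).toSphere := by
      refine lintegral_mono fun x => ?_
      refine le_trans (le_of_eq ?_) (lintegral_hePhiCoeff_mul_trace_le
        (hφ.contDiffOn_component x) hδ₀ (hK x))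
      refine setLIntegral_congr_fun measurableSet_Ioi fun y hy => ?_
      simp only [OneForm.abs_trWedgeStar_hePhi h hφy x hy]
    _ = heBound * (volume : Measure E4).toSphere Set.univ +
          ∫⁻ p, ENNReal.ofReal (energyDensity (φ.component p.1) p.2) ∂volM := by
      rw [lintegral_add_left measurable_const, lintegral_const, volM,
        lintegral_prod _ hφ.aemeasurable_energyDensity.ennreal_ofReal]
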